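/- Let $d\ge 1$ and $p_1,\dots,p_d\ge 1$ be integers, $p=p_1+\dots+p_d$, and let $X=(X_1,\dots,X_d)$ be a random vector in $\mathbb R^p=\mathbb R^{p_1}\times\dots\times\mathbb R^{p_d}$ with $\mathrm E|X|<\infty$. Let $X^1,X^2,\dots$ be i.i.d. copies of $X$, and for $n\ge1$ let $\mathbf X=\{X^1,\dots,X^n\}$. For $t=(t_1,\dots,t_d)\in\mathbb R^p$ put $$\phi_X(t)=\mathrm E\,e^{i\langle t,X\rangle},\qquad \phi_{\widetilde X}(t)=\prod_{j=1}^d \mathrm E\,e^{i\langle t_j,X_j\rangle},$$ $$\phi^n_X(t)=\frac1n\sum_{k=1}^n e^{i\langle t,X^k\rangle},\qquad \phi^n_{\widetilde X}(t)=\prod_{j=1}^d\Big(\frac1n\sum_{k=1}^n e^{i\langle t_j,X^k_j\rangle}\Big),\qquad \phi^{n\star}_{\widetilde X}(t)=\frac1n\sum_{k=1}^n e^{i\sum_{j=1}^d\langle t_j,X_j^{k+j-1}\rangle},$$ where in the last formula the upper indices are read cyclically modulo $n$ in $\{1,\dots,n\}$. Let $$w_1(t)=\frac1{K_p|t|^{p+1}},\qquad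 K_p=\frac{2\pi^{p/2}\,\Gamma(1/2)}{2\,\Gamma((p+1)/2)},$$ and define $$\mathcal Q(X)=\int_{\mathbb R^p}|\phi_X-\phi_{\widetilde X}|^2w_1\,dt,\quad \mathcal Q_n(\mathbf X)=\int_{\mathbb R^p}|\phi^n_X-\phi^n_{\widetilde X}|^2w_1\,dt,\quad \mathcal Q^\star_n(\mathbf X)=\int_{\mathbb R^p}|\phi^n_X-\phi^{n\star}_{\widetilde X}|^2w_1\,dt .$$ Then these integrals are finite for every $n\ge 1$ and every realization of the sample, and $$\mathcal Q_n(\mathbf X)\longrightarrow\mathcal Q(X)\quad\text{and}\quad \mathcal Q^\star_n(\mathbf X)\longrightarrow\mathcal Q(X)\qquad\text{almost surely as } n\to\infty .$$ -/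

import Mathlib

open MeasureTheory ProbabilityTheory Filter Topology

namespace MutualDependence

noncomputable section

/-- The space `ℝ^{p_1} × ⋯ × ℝ^{p_d} = ℝ^p` of vectors `t = (t_1, …, t_d)`, with its Euclidean
norm, its Euclidean inner product and Lebesgue measure; `t j` is the block `t_j`. -/
abbrev BlockSpace {d : ℕ} (p : Fin d → ℕ) : Type :=
  PiLp 2 (fun j : Fin d => EuclideanSpace ℝ (Fin (p j)))

/-- The total dimension `p = p_1 + ⋯ + p_d`. -/
def totalDim {d : ℕ} (p : Fin d → ℕ) : ℕ := ∑ j, p j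

/-- `K(q, m) = 2 π^{q/2} Γ(1 - m/2) / (m 2^m Γ((q + m)/2))`. -/
def K (q : ℕ) (m : ℝ) : ℝ :=
  (2 * Real.pi ^ ((q : ℝ) / 2) * Real.Gamma (1 - m / 2)) /
    (m * (2 : ℝ) ^ m * Real.Gamma (((q : ℝ) + m) / 2))

/-- The weight function `w₁(t) = (K(p, 1) |t|^{p+1})⁻¹`. -/
def w₁ {d : ℕ} {p : Fin d → ℕ} (t : BlockSpace p) : ℝ :=
  (K (totalDim p) 1 * ‖t‖ ^ (totalDim p + 1))⁻¹

/-- The integrand `|η(t)|² w₁(t)` of the squared weighted norm. -/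
def weightedSq {d : ℕ} {p : Fin d → ℕ} (η : BlockSpace p → ℂ) (t : BlockSpace p) : ℝ :=
  ‖η t‖ ^ 2 * w₁ t

/-- The squared weighted norm `‖η‖²_{w₁} = ∫ |η(t)|² w₁(t) dt` over `ℝ^p`. -/
def weightedNormSq {d : ℕ} {p : Fin d → ℕ} (η : BlockSpace p → ℂ) : ℝ :=
  ∫ t, weightedSq η t

section Population

variable {d : ℕ} {p : Fin d → ℕ} {Ω : Type*} [MeasurableSpace Ω]

/-- The joint characteristic function `φ_X(t) = E exp(i⟨t, X⟩)`. -/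
def jointCF (P : Measure Ω) (X : Ω → BlockSpace p) (t : BlockSpace p) : ℂ :=
  charFun (P.map X) t

/-- The characteristic function `∏_j E exp(i⟨t_j, X_j⟩)` of the vector with independent blocks
that have the same marginal laws as `X_1, …, X_d`. -/
def productCF (P : Measure Ω) (X : Ω → BlockSpace p) (t : BlockSpace p) : ℂ :=
  ∏ j, charFun (P.map (fun ω => X ω j)) (t j)

/-- The difference of the two characteristic functions. -/
def cfDiff (P : Measure Ω) (X : Ω → BlockSpace p) (t : BlockSpace p) : ℂ :=
  jointCF P X t - productCF P X t

/-- The complete measure of mutual dependence `𝒬(X)`. -/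
def Q (P : Measure Ω) (X : Ω → BlockSpace p) : ℝ :=
  weightedNormSq (cfDiff P X)

end Population

section Sample

/-! The sample of size `n` consists of the first `n` terms `x 0, …, x (n - 1)` of a sequence `x`. -/

variable {d : ℕ} {p : Fin d → ℕ}

/-- The empirical joint characteristic function `(1/n) ∑_k exp(i⟨t, x^k⟩)`. -/
def empJointCF (n : ℕ) (x : ℕ → BlockSpace p) (t : BlockSpace p) : ℂ :=
  (1 / (n : ℂ)) * ∑ k ∈ Finset.range n, Complex.exp (Complex.I * ((inner ℝ t (x k) : ℝ) : ℂ))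

/-- The product `∏_j (1/n) ∑_k exp(i⟨t_j, x^k_j⟩)` of the empirical marginal characteristic
functions. -/
def empProductCF (n : ℕ) (x : ℕ → BlockSpace p) (t : BlockSpace p) : ℂ :=
  ∏ j, ((1 / (n : ℂ)) *
    ∑ k ∈ Finset.range n, Complex.exp (Complex.I * ((inner ℝ (t j) (x k j) : ℝ) : ℂ)))

/-- The simplified version `(1/n) ∑_k exp(i ∑_j ⟨t_j, x_j^{k+j-1}⟩)`, where the upper index is
read cyclically modulo `n`. Since `k` and `j` both start from `0` here, the index is
`(k + j) % n`. -/
def empSimplifiedCF (n : ℕ) (x : ℕ → BlockSpace p) (t : BlockSpace p) : ℂ :=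
  (1 / (n : ℂ)) * ∑ k ∈ Finset.range n,
    Complex.exp (Complex.I * ((∑ j : Fin d, inner ℝ (t j) (x ((k + (j : ℕ)) % n) j) : ℝ) : ℂ))

/-- The difference of the empirical joint and the empirical product characteristic function. -/
def empDiff (n : ℕ) (x : ℕ → BlockSpace p) (t : BlockSpace p) : ℂ :=
  empJointCF n x t - empProductCF n x t

/-- The difference of the empirical joint and the simplified product characteristic function. -/
def empSimplifiedDiff (n : ℕ) (x : ℕ → BlockSpace p) (t : BlockSpace p) : ℂ :=
  empJointCF n x t - empSimplifiedCF n x t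

/-- The empirical complete measure of mutual dependence `𝒬_n`. -/
def empQ (n : ℕ) (x : ℕ → BlockSpace p) : ℝ :=
  weightedNormSq (empDiff n x)

/-- The simplified empirical complete measure of mutual dependence `𝒬_n^⋆`. -/
def empQStar (n : ℕ) (x : ℕ → BlockSpace p) : ℝ :=
  weightedNormSq (empSimplifiedDiff n x)

end Sample

end

end MutualDependence

/-! The proof is dominated convergence, for one sample path outside a null set. Domination: each
difference `η` of empirical characteristic functions satisfies `‖η t‖ ≤ 2` and `‖η t‖ ≤ ‖t‖ * M`,
where `M` is a multiple of the mean norm of the sample, almost surely bounded in `n` by the strong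
law since `E|X| < ∞`. So `‖η‖² w₁` is at most a constant times `‖t‖² / (1 + ‖t‖²) / ‖t‖ ^ (p + 1)`,
which is integrable (`integrable_dominatingProfile`, `norm_weightedSq_le`). Pointwise limits: the
strong law gives them at countably many `t`, and the Lipschitz bound by the mean norm extends them
to all `t` (`tendsto_ecf_of_dense`). The summands of the simplified version are dependent, but only
at short range, so the strong law holds along each residue class of indices
(`ae_tendsto_average_of_gap_indep`). -/

namespace MutualDependence

noncomputable section

/-! ### Empirical characteristic functions and their Lipschitz bounds. -/

section EmpiricalCharFun

/-- The mean norm of the first `n` terms of a sequence. -/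
def meanNorm {E : Type*} [NormedAddCommGroup E] (n : ℕ) (x : ℕ → E) : ℝ := (n : ℝ)⁻¹ * ∑ k ∈ Finset.range n, ‖x k‖

lemma meanNorm_nonneg {E : Type*} [NormedAddCommGroup E] (n : ℕ) (x : ℕ → E) : 0 ≤ meanNorm n x := by
  unfold meanNorm; positivity

variable {E : Type*} [NormedAddCommGroup E] [InnerProductSpace ℝ E]

/-- The empirical characteristic function of the first `n` terms of a sequence. -/
def ecf (n : ℕ) (x : ℕ → E) (t : E) : ℂ :=
  (1 / (n : ℂ)) * ∑ k ∈ Finset.range n, Complex.exp (Complex.I * ((inner ℝ t (x k) : ℝ) : ℂ))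

/-- The convention `1 / 0 = 0` makes `ecf 0 x` vanish identically, hence `1 ≤ n`. -/
lemma ecf_zero {n : ℕ} (hn : 1 ≤ n) (x : ℕ → E) : ecf n x 0 = 1 := by
  have : (n : ℂ) ≠ 0 := by exact_mod_cast (by omega : n ≠ 0)
  simp [ecf, this]

lemma norm_ecf_le_one (n : ℕ) (x : ℕ → E) (t : E) : ‖ecf n x t‖ ≤ 1 := by
  have h : ‖∑ k ∈ Finset.range n, Complex.exp (Complex.I * ((inner ℝ t (x k) : ℝ) : ℂ))‖ ≤ n := by
    refine (norm_sum_le _ _).trans ?_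
    simp [Complex.norm_exp_I_mul_ofReal]
  rw [ecf, norm_mul, norm_div, norm_one, Complex.norm_natCast, one_div, inv_mul_eq_div]
  exact div_le_one_of_le₀ h (Nat.cast_nonneg _)

lemma norm_exp_I_mul_sub_exp_I_mul_le (a b : ℝ) :
    ‖Complex.exp (Complex.I * a) - Complex.exp (Complex.I * b)‖ ≤ |a - b| := by
  have h : Complex.exp (Complex.I * a) - Complex.exp (Complex.I * b)
      = Complex.exp (Complex.I * b) * (Complex.exp (Complex.I * ((a - b : ℝ) : ℂ)) - 1) := by
    rw [mul_sub, ← Complex.exp_add]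
    congr 2
    · push_cast; ring
    · ring
  rw [h, norm_mul, Complex.norm_exp_I_mul_ofReal, one_mul, ← Real.norm_eq_abs]
  exact Real.norm_exp_I_mul_ofReal_sub_one_le

lemma norm_ecf_sub_le (n : ℕ) (x : ℕ → E) (s t : E) :
    ‖ecf n x s - ecf n x t‖ ≤ ‖s - t‖ * meanNorm n x := by
  rw [ecf, ecf, ← mul_sub, ← Finset.sum_sub_distrib, norm_mul, norm_div, norm_one,
    Complex.norm_natCast, one_div, meanNorm, mul_left_comm, Finset.mul_sum]
  gcongr
  refine (norm_sum_le _ _).trans (Finset.sum_le_sum fun k _ => ?_)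
  refine (norm_exp_I_mul_sub_exp_I_mul_le _ _).trans ?_
  rw [← inner_sub_left]
  exact abs_real_inner_le_norm _ _

lemma norm_ecf_sub_one_le {n : ℕ} (hn : 1 ≤ n) (x : ℕ → E) (t : E) :
    ‖ecf n x t - 1‖ ≤ ‖t‖ * meanNorm n x := by
  simpa [ecf_zero hn] using norm_ecf_sub_le n x t 0

lemma continuous_ecf (n : ℕ) (x : ℕ → E) : Continuous (ecf n x) := by
  unfold ecf; fun_prop

/-- Bounded mean norms are uniform Lipschitz constants, and for an equicontinuous sequence the set
of points of convergence to a continuous limit is closed. -/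
lemma tendsto_ecf_of_dense {x : ℕ → ℕ → E} {φ : E → ℂ} (hφ : Continuous φ) {M : ℝ}
    (hM : ∀ n, meanNorm n (x n) ≤ M) {D : Set E} (hD : Dense D)
    (h : ∀ t ∈ D, Tendsto (fun n => ecf n (x n) t) atTop (𝓝 (φ t))) (t : E) :
    Tendsto (fun n => ecf n (x n) t) atTop (𝓝 (φ t)) := by
  have he : Equicontinuous (fun n => ecf n (x n)) := by
    refine Metric.equicontinuous_of_continuity_modulus (fun r => r * M) ?_ _ ?_
    · have : Tendsto (fun r : ℝ => r * M) (𝓝 0) (𝓝 (0 * M)) := tendsto_id.mul_const M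
      simpa using this
    · intro s t n
      rw [dist_eq_norm, dist_eq_norm]
      exact (norm_ecf_sub_le _ _ _ _).trans (by gcongr; exact hM n)
  have hc := he.isClosed_setOfPred_tendsto (l := atTop) hφ
  have : closure D ⊆ {t | Tendsto (fun n => ecf n (x n) t) atTop (𝓝 (φ t))} :=
    closure_minimal h hc
  exact this (hD t)

end EmpiricalCharFun

section Products

lemma norm_prod_sub_one_le {ι : Type*} (s : Finset ι) (f : ι → ℂ) (hf : ∀ i, ‖f i‖ ≤ 1) :
    ‖∏ i ∈ s, f i - 1‖ ≤ ∑ i ∈ s, ‖f i - 1‖ := by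
  classical
  induction s using Finset.induction_on with
  | empty => simp
  | insert a s ha ih =>
    rw [Finset.prod_insert ha, Finset.sum_insert ha]
    have h : f a * ∏ i ∈ s, f i - 1 = (f a - 1) + f a * (∏ i ∈ s, f i - 1) := by ring
    rw [h]
    refine (norm_add_le _ _).trans ?_
    rw [norm_mul]
    gcongr
    calc ‖f a‖ * ‖∏ i ∈ s, f i - 1‖ ≤ 1 * ‖∏ i ∈ s, f i - 1‖ := by gcongr; exact hf a
      _ ≤ _ := by rw [one_mul]; exact ih

lemma norm_prod_le_one {ι : Type*} (s : Finset ι) (f : ι → ℂ) (hf : ∀ i, ‖f i‖ ≤ 1) :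
    ‖∏ i ∈ s, f i‖ ≤ 1 := by
  rw [norm_prod]
  exact Finset.prod_le_one (fun _ _ => norm_nonneg _) fun i _ => hf i

end Products

/-! ### Strong law under short-range dependence. -/

section LawOfLargeNumbers

lemma sum_range_mul_eq_sum_residues {A : Type*} [AddCommMonoid A] (m n : ℕ) (y : ℕ → A) :
    ∑ k ∈ Finset.range (m * n), y k
      = ∑ r ∈ Finset.range m, ∑ i ∈ Finset.range n, y (m * i + r) := by
  induction n with
  | zero => simp
  | succ n ih =>
    rw [Nat.mul_succ, Finset.sum_range_add, ih, ← Finset.sum_add_distrib]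
    exact Finset.sum_congr rfl fun r _ => (Finset.sum_range_succ _ _).symm

lemma tendsto_natDiv_div (m : ℕ) (hm : 0 < m) :
    Tendsto (fun n : ℕ => ((n / m : ℕ) : ℝ) / n) atTop (𝓝 (1 / m)) := by
  have h := (tendsto_nat_floor_mul_div_atTop (R := ℝ) (a := 1 / m) (by positivity)).comp
    tendsto_natCast_atTop_atTop
  refine h.congr fun n => ?_
  simp only [Function.comp_apply]
  congr 2
  rw [one_div_mul_eq_div, Nat.floor_div_natCast, Nat.floor_natCast]

/-- Convergence of averages along each residue class implies convergence of the averages, also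
after a change of boundedly many terms. -/
lemma tendsto_average_of_residues {y : ℕ → ℂ} {B : ℝ} {m : ℕ} (hm : 0 < m) {c : ℂ}
    (hB : ∀ k, ‖y k‖ ≤ B)
    (h : ∀ r < m, Tendsto (fun n : ℕ => (n : ℝ)⁻¹ • ∑ i ∈ Finset.range n, y (m * i + r))
      atTop (𝓝 c)) {s : ℕ → ℂ} {C : ℝ}
    (hs : ∀ n, ‖s n - ∑ k ∈ Finset.range n, y k‖ ≤ C) :
    Tendsto (fun n : ℕ => (1 / (n : ℂ)) * s n) atTop (𝓝 c) := by
  have hB0 : 0 ≤ B := (norm_nonneg _).trans (hB 0)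
  have h1 : Tendsto (fun n : ℕ => (n : ℝ)⁻¹ • ∑ k ∈ Finset.range (m * n), y k) atTop
      (𝓝 (m • c)) := by
    have := tendsto_finsetSum (Finset.range m) fun r hr => h r (Finset.mem_range.1 hr)
    simp only [Finset.sum_const, Finset.card_range] at this
    refine this.congr fun n => ?_
    rw [sum_range_mul_eq_sum_residues, Finset.smul_sum]
  have h2 : Tendsto (fun n : ℕ => (((n / m : ℕ) : ℝ) / n) •
      (((n / m : ℕ) : ℝ)⁻¹ • ∑ k ∈ Finset.range (m * (n / m)), y k)) atTop (𝓝 c) := by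
    have := (tendsto_natDiv_div m hm).smul (h1.comp (Nat.tendsto_div_const_atTop hm.ne'))
    have hc : ((1 : ℝ) / m) • (m • c) = c := by
      have : (m : ℂ) ≠ 0 := by exact_mod_cast hm.ne'
      rw [Complex.real_smul, nsmul_eq_mul]; push_cast; field_simp
    rwa [hc] at this
  -- Passing from `s n` to the largest full block of `m * (n / m)` terms costs `C` for the altered
  -- sum and at most `m * B` for the fewer than `m` leftover terms.
  have h3 : Tendsto (fun n : ℕ => (1 / (n : ℂ)) * s n - (((n / m : ℕ) : ℝ) / n) •
      (((n / m : ℕ) : ℝ)⁻¹ • ∑ k ∈ Finset.range (m * (n / m)), y k)) atTop (𝓝 0) := by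
    have hlim : Tendsto (fun n : ℕ => (C + m * B) / (n : ℝ)) atTop (𝓝 0) :=
      tendsto_const_nhds.div_atTop tendsto_natCast_atTop_atTop
    refine squeeze_zero_norm (fun n => ?_) hlim
    have hsplit : ∑ k ∈ Finset.range n, y k = ∑ k ∈ Finset.range (m * (n / m)), y k
        + ∑ i ∈ Finset.range (n % m), y (m * (n / m) + i) := by
      rw [← Finset.sum_range_add, Nat.div_add_mod]
    have hrem : ‖∑ i ∈ Finset.range (n % m), y (m * (n / m) + i)‖ ≤ m * B := by
      refine (norm_sum_le_of_le _ fun i _ => hB _).trans ?_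
      simp only [Finset.sum_const, Finset.card_range, nsmul_eq_mul]
      gcongr
      exact (Nat.mod_lt n hm).le
    have hdiff : ‖s n - ∑ k ∈ Finset.range (m * (n / m)), y k‖ ≤ C + m * B := by
      have : s n - ∑ k ∈ Finset.range (m * (n / m)), y k = (s n - ∑ k ∈ Finset.range n, y k)
          + ∑ i ∈ Finset.range (n % m), y (m * (n / m) + i) := by rw [hsplit]; ring
      rw [this]
      exact (norm_add_le _ _).trans (add_le_add (hs n) hrem)
    have hsm : (((n / m : ℕ) : ℝ) / n) •
        (((n / m : ℕ) : ℝ)⁻¹ • ∑ k ∈ Finset.range (m * (n / m)), y k)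
        = (1 / (n : ℂ)) * ∑ k ∈ Finset.range (m * (n / m)), y k := by
      rcases Nat.eq_zero_or_pos (n / m) with h0 | h0
      · simp [h0]
      · have : ((n / m : ℕ) : ℝ) ≠ 0 := by positivity
        rw [smul_smul, div_mul_eq_mul_div, mul_inv_cancel₀ this, Complex.real_smul]
        push_cast; rfl
    rw [hsm, ← mul_sub, norm_mul, norm_div, norm_one, Complex.norm_natCast, one_div_mul_eq_div]
    gcongr
  simpa using h3.add h2

/-- The strong law of large numbers for bounded functions of an identically distributed sequence
whose terms are independent as soon as their indices differ by at least `m`. -/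
lemma ae_tendsto_average_of_gap_indep {Ω : Type*} [MeasurableSpace Ω] {P : Measure Ω}
    [IsProbabilityMeasure P] {Z : ℕ → Ω → ℂ} {m : ℕ} (hm : 0 < m) {B : ℝ}
    (hB : ∀ k ω, ‖Z k ω‖ ≤ B)
    (hindep : ∀ a b, a + m ≤ b → IndepFun (Z a) (Z b) P)
    (hident : ∀ k, IdentDistrib (Z k) (Z 0) P P) :
    ∀ᵐ ω ∂P, ∀ (s : ℕ → ℂ) (C : ℝ), (∀ n, ‖s n - ∑ k ∈ Finset.range n, Z k ω‖ ≤ C) →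
      Tendsto (fun n : ℕ => (1 / (n : ℂ)) * s n) atTop (𝓝 (∫ ω, Z 0 ω ∂P)) := by
  -- Indices in one residue class modulo `m` are at least `m` apart. This gives only pairwise
  -- independence, which suffices for `strong_law_ae`.
  have hres : ∀ r, ∀ᵐ ω ∂P, Tendsto
      (fun n : ℕ => (n : ℝ)⁻¹ • ∑ i ∈ Finset.range n, Z (m * i + r) ω) atTop
      (𝓝 (∫ ω, Z 0 ω ∂P)) := by
    intro r
    have hmean : ∫ ω, Z r ω ∂P = ∫ ω, Z 0 ω ∂P := (hident r).integral_eq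
    rw [← hmean]
    have hpair : Pairwise fun i j => IndepFun (Z (m * i + r)) (Z (m * j + r)) P := by
      have hlt : ∀ i j, i < j → IndepFun (Z (m * i + r)) (Z (m * j + r)) P := by
        intro i j hij
        refine hindep _ _ ?_
        have : m * (i + 1) ≤ m * j := Nat.mul_le_mul_left m hij
        rw [Nat.mul_succ] at this; omega
      intro i j hij
      rcases lt_or_gt_of_ne hij with h | h
      · exact hlt i j h
      · exact (hlt j i h).symm
    have := strong_law_ae (μ := P) (fun i => Z (m * i + r))
      (Integrable.of_bound (hident _).aemeasurable_fst.aestronglyMeasurable B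
        (Eventually.of_forall (hB _))) hpair (fun i => (hident _).trans (hident _).symm)
    simpa using this
  filter_upwards [ae_all_iff.2 hres] with ω hω s C hs
  exact tendsto_average_of_residues hm (fun k => hB k ω) (fun r _ => hω r) hs

end LawOfLargeNumbers

/-! ### Integrability of the dominating function. -/

section Radial

/-- The radial function that dominates the weighted squares of differences of characteristic
functions. -/
def dominatingProfile (q : ℕ) (r : ℝ) : ℝ := r ^ 2 / (1 + r ^ 2) * (r ^ (q + 1))⁻¹

/-- In polar coordinates the Jacobian `r ^ (q - 1)` turns the profile into `1 / (1 + r ^ 2)`. -/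
lemma integrable_dominatingProfile {E : Type*} [NormedAddCommGroup E] [NormedSpace ℝ E]
    [FiniteDimensional ℝ E] [Nontrivial E] [MeasurableSpace E] [BorelSpace E] (μ : Measure E)
    [μ.IsAddHaarMeasure] :
    Integrable (fun t : E => dominatingProfile (Module.finrank ℝ E) ‖t‖) μ := by
  rw [integrable_fun_norm_addHaar μ (f := dominatingProfile (Module.finrank ℝ E))]
  have hq : 0 < Module.finrank ℝ E := Module.finrank_pos
  refine (integrable_inv_one_add_sq.integrableOn (s := Set.Ioi (0 : ℝ))).congr_fun ?_
    measurableSet_Ioi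
  intro r hr
  have hr : 0 < r := hr
  obtain ⟨q, hq'⟩ : ∃ q, Module.finrank ℝ E = q + 1 := ⟨_, (Nat.sub_add_cancel hq).symm⟩
  simp only [dominatingProfile, hq', smul_eq_mul, Nat.add_sub_cancel]
  field_simp
  ring

end Radial

/-! ### Dominated convergence for the weighted norm. -/

section Domination

variable {d : ℕ} {p : Fin d → ℕ}

lemma finrank_blockSpace : Module.finrank ℝ (BlockSpace p) = totalDim p := by
  rw [totalDim, (WithLp.linearEquiv 2 ℝ (∀ j, EuclideanSpace ℝ (Fin (p j)))).finrank_eq,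
    Module.finrank_pi_fintype]
  simp

lemma integrable_dominatingProfile_blockSpace :
    Integrable (fun t : BlockSpace p => dominatingProfile (totalDim p) ‖t‖) := by
  -- Total dimension zero is allowed; the space is then a point, where the profile is `0`.
  rcases subsingleton_or_nontrivial (BlockSpace p) with h | h
  · have : (fun t : BlockSpace p => dominatingProfile (totalDim p) ‖t‖) = 0 := by
      funext t
      simp [Subsingleton.elim t 0, dominatingProfile]
    rw [this]
    exact integrable_zero _ _ _
  · rw [← finrank_blockSpace]
    exact integrable_dominatingProfile volume

/-- The constant in front of the dominating function. -/
def dominatingConst (p : Fin d → ℕ) (M : ℝ) : ℝ := (4 + M ^ 2) * |(K (totalDim p) 1)⁻¹|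

lemma norm_weightedSq_le {η : BlockSpace p → ℂ} {M : ℝ} {t : BlockSpace p}
    (h2 : ‖η t‖ ≤ 2) (hM : ‖η t‖ ≤ ‖t‖ * M) :
    ‖weightedSq η t‖ ≤ dominatingConst p M * dominatingProfile (totalDim p) ‖t‖ := by
  -- In `‖η t‖ ^ 2 * (1 + ‖t‖ ^ 2)`, the first product is bounded through `hM` and the second
  -- through `h2`.
  have hsq : ‖η t‖ ^ 2 ≤ (4 + M ^ 2) * (‖t‖ ^ 2 / (1 + ‖t‖ ^ 2)) := by
    have h4 : ‖η t‖ ^ 2 ≤ 4 := by nlinarith [norm_nonneg (η t)]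
    have hM2 : ‖η t‖ ^ 2 ≤ ‖t‖ ^ 2 * M ^ 2 := by
      rw [← mul_pow]; exact pow_le_pow_left₀ (norm_nonneg _) hM 2
    rw [← mul_div_assoc, le_div_iff₀ (by positivity)]
    nlinarith [mul_le_mul_of_nonneg_right h4 (sq_nonneg ‖t‖)]
  rw [weightedSq, w₁, norm_mul, mul_inv, norm_mul, norm_inv, norm_inv, norm_pow, norm_pow,
    norm_norm, norm_norm, dominatingConst, dominatingProfile, abs_inv, Real.norm_eq_abs]
  calc ‖η t‖ ^ 2 * (|K (totalDim p) 1|⁻¹ * (‖t‖ ^ (totalDim p + 1))⁻¹)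
      ≤ (4 + M ^ 2) * (‖t‖ ^ 2 / (1 + ‖t‖ ^ 2)) *
        (|K (totalDim p) 1|⁻¹ * (‖t‖ ^ (totalDim p + 1))⁻¹) := by gcongr
    _ = _ := by ring

lemma aestronglyMeasurable_weightedSq {η : BlockSpace p → ℂ} (hη : Continuous η) :
    AEStronglyMeasurable (weightedSq η) := by
  have : Measurable (weightedSq η) := by
    unfold weightedSq w₁
    have := hη.measurable
    fun_prop
  exact this.aestronglyMeasurable

lemma integrable_weightedSq {η : BlockSpace p → ℂ} (hη : Continuous η) {M : ℝ}
    (h2 : ∀ t, ‖η t‖ ≤ 2) (hM : ∀ t, ‖η t‖ ≤ ‖t‖ * M) : Integrable (weightedSq η) :=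
  (integrable_dominatingProfile_blockSpace.const_mul (dominatingConst p M)).mono'
    (aestronglyMeasurable_weightedSq hη)
    (Eventually.of_forall fun t => norm_weightedSq_le (h2 t) (hM t))

lemma tendsto_weightedNormSq {η : ℕ → BlockSpace p → ℂ} {ζ : BlockSpace p → ℂ}
    (hη : ∀ n, Continuous (η n)) {M : ℝ} (h2 : ∀ n t, ‖η n t‖ ≤ 2)
    (hM : ∀ n, 1 ≤ n → ∀ t, ‖η n t‖ ≤ ‖t‖ * M)
    (hlim : ∀ t, Tendsto (fun n => η n t) atTop (𝓝 (ζ t))) :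
    Tendsto (fun n => weightedNormSq (η n)) atTop (𝓝 (weightedNormSq ζ)) := by
  refine tendsto_integral_filter_of_dominated_convergence
    (fun t => dominatingConst p M * dominatingProfile (totalDim p) ‖t‖)
    (Eventually.of_forall fun n => aestronglyMeasurable_weightedSq (hη n)) ?_
    (integrable_dominatingProfile_blockSpace.const_mul _) ?_
  · filter_upwards [eventually_ge_atTop 1] with n hn
    exact Eventually.of_forall fun t => norm_weightedSq_le (h2 n t) (hM n hn t)
  · exact Eventually.of_forall fun t => ((hlim t).norm.pow 2).mul_const _

end Domination

/-! ### Deterministic bounds for the sample quantities. -/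

section Sample

variable {d : ℕ} {p : Fin d → ℕ}

/-- The vectors whose `j`-th block is the `j`-th block of the observation with index `k + j`,
read cyclically modulo `n`. -/
def cyclicBlocks (n : ℕ) (x : ℕ → BlockSpace p) (k : ℕ) : BlockSpace p :=
  WithLp.toLp 2 fun j => x ((k + (j : ℕ)) % n) j

/-- The vectors whose `j`-th block is the `j`-th block of the observation with index `k + j`. -/
def shiftedBlocks (x : ℕ → BlockSpace p) (k : ℕ) : BlockSpace p :=
  WithLp.toLp 2 fun j => x (k + (j : ℕ)) j

lemma empJointCF_eq (n : ℕ) (x : ℕ → BlockSpace p) : empJointCF n x = ecf n x := rfl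

lemma empProductCF_eq (n : ℕ) (x : ℕ → BlockSpace p) :
    empProductCF n x = fun t => ∏ j, ecf n (fun k => x k j) (t j) := rfl

lemma empSimplifiedCF_eq (n : ℕ) (x : ℕ → BlockSpace p) :
    empSimplifiedCF n x = ecf n (cyclicBlocks n x) := by
  funext t
  simp [empSimplifiedCF, ecf, cyclicBlocks, PiLp.inner_apply]

/-- Wrap-around affects only the end of the sample; elsewhere the vectors belong to a sequence that
does not depend on `n`, to which a law of large numbers can apply. -/
lemma cyclicBlocks_eq_shiftedBlocks {n k : ℕ} (x : ℕ → BlockSpace p) (h : k + d ≤ n) :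
    cyclicBlocks n x k = shiftedBlocks x k := by
  unfold cyclicBlocks shiftedBlocks
  congr 1
  funext j
  rw [Nat.mod_eq_of_lt (by omega)]

lemma sum_range_cyclic {A : Type*} [AddCommMonoid A] (n j : ℕ) (f : ℕ → A) :
    ∑ k ∈ Finset.range n, f ((k + j) % n) = ∑ k ∈ Finset.range n, f k := by
  rcases Nat.eq_zero_or_pos n with rfl | hn
  · simp
  have hmaps : Set.MapsTo (fun k => (k + j) % n) (Finset.range n : Set ℕ)
      (Finset.range n : Set ℕ) := fun k _ => by simpa using Nat.mod_lt _ hn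
  have hinj : Set.InjOn (fun k => (k + j) % n) (Finset.range n : Set ℕ) := by
    intro a ha b hb hab
    have : a ≡ b [MOD n] := Nat.ModEq.add_right_cancel' j hab
    exact this.eq_of_lt_of_lt (by simpa using ha) (by simpa using hb)
  refine Finset.sum_nbij (fun k => (k + j) % n) hmaps hinj ?_ fun _ _ => rfl
  exact Finset.surjOn_of_injOn_of_card_le _ hmaps hinj le_rfl

lemma norm_blockSpace_le_sum (v : BlockSpace p) : ‖v‖ ≤ ∑ j, ‖v j‖ := by
  rw [PiLp.norm_eq_of_L2 v]
  refine Real.sqrt_le_iff.2 ⟨Finset.sum_nonneg fun _ _ => norm_nonneg _, ?_⟩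
  exact Finset.sum_sq_le_sq_sum_of_nonneg fun _ _ => norm_nonneg _

lemma meanNorm_block_le (n : ℕ) (x : ℕ → BlockSpace p) (j : Fin d) :
    meanNorm n (fun k => x k j) ≤ meanNorm n x := by
  unfold meanNorm
  gcongr
  exact PiLp.norm_apply_le _ _

lemma meanNorm_cyclicBlocks_le (n : ℕ) (x : ℕ → BlockSpace p) :
    meanNorm n (cyclicBlocks n x) ≤ d * meanNorm n x := by
  unfold meanNorm
  rw [mul_left_comm]
  gcongr
  calc ∑ k ∈ Finset.range n, ‖cyclicBlocks n x k‖
      ≤ ∑ k ∈ Finset.range n, ∑ j : Fin d, ‖x ((k + (j : ℕ)) % n)‖ := by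
        refine Finset.sum_le_sum fun k _ => (norm_blockSpace_le_sum _).trans ?_
        exact Finset.sum_le_sum fun j _ => PiLp.norm_apply_le (x ((k + (j : ℕ)) % n)) j
    _ = ∑ j : Fin d, ∑ k ∈ Finset.range n, ‖x ((k + (j : ℕ)) % n)‖ := Finset.sum_comm
    _ = ∑ j : Fin d, ∑ k ∈ Finset.range n, ‖x k‖ :=
        Finset.sum_congr rfl fun j _ => sum_range_cyclic n j fun k => ‖x k‖
    _ = d * ∑ k ∈ Finset.range n, ‖x k‖ := by simp

lemma continuous_empDiff (n : ℕ) (x : ℕ → BlockSpace p) : Continuous (empDiff n x) := by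
  unfold empDiff
  rw [empJointCF_eq, empProductCF_eq]
  refine (continuous_ecf n x).sub (continuous_finsetProd _ fun j _ => ?_)
  exact (continuous_ecf n _).comp (by fun_prop)

lemma continuous_empSimplifiedDiff (n : ℕ) (x : ℕ → BlockSpace p) :
    Continuous (empSimplifiedDiff n x) := by
  unfold empSimplifiedDiff
  rw [empJointCF_eq, empSimplifiedCF_eq]
  exact (continuous_ecf n x).sub (continuous_ecf n _)

lemma norm_empDiff_le_two (n : ℕ) (x : ℕ → BlockSpace p) (t : BlockSpace p) :
    ‖empDiff n x t‖ ≤ 2 := by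
  refine (norm_sub_le _ _).trans ?_
  have h1 := norm_ecf_le_one n x t
  have h2 := norm_prod_le_one Finset.univ (fun j => ecf n (fun k => x k j) (t j))
    fun j => norm_ecf_le_one _ _ _
  rw [empJointCF_eq, empProductCF_eq]
  linarith

lemma norm_empSimplifiedDiff_le_two (n : ℕ) (x : ℕ → BlockSpace p) (t : BlockSpace p) :
    ‖empSimplifiedDiff n x t‖ ≤ 2 := by
  refine (norm_sub_le _ _).trans ?_
  have h1 := norm_ecf_le_one n x t
  have h2 := norm_ecf_le_one n (cyclicBlocks n x) t
  rw [empJointCF_eq, empSimplifiedCF_eq]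
  linarith

/-- Both terms are compared with `1`, their common value at `0`: the joint one costs one mean norm,
the product one for each of its `d` factors. -/
lemma norm_empDiff_le {n : ℕ} (hn : 1 ≤ n) (x : ℕ → BlockSpace p) (t : BlockSpace p) :
    ‖empDiff n x t‖ ≤ ‖t‖ * ((1 + d) * meanNorm n x) := by
  have h1 := norm_ecf_sub_one_le hn x t
  have h2 : ‖∏ j, ecf n (fun k => x k j) (t j) - 1‖ ≤ d * (‖t‖ * meanNorm n x) := by
    refine (norm_prod_sub_one_le _ _ fun j => norm_ecf_le_one _ _ _).trans ?_
    have : ∀ j ∈ (Finset.univ : Finset (Fin d)),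
        ‖ecf n (fun k => x k j) (t j) - 1‖ ≤ ‖t‖ * meanNorm n x := by
      intro j _
      refine (norm_ecf_sub_one_le hn _ _).trans ?_
      exact mul_le_mul (PiLp.norm_apply_le _ _) (meanNorm_block_le n x j) (meanNorm_nonneg _ _)
        (norm_nonneg _)
    simpa using Finset.sum_le_card_nsmul _ _ _ this
  have h3 := norm_sub_le (ecf n x t - 1) (∏ j, ecf n (fun k => x k j) (t j) - 1)
  rw [sub_sub_sub_cancel_right] at h3
  rw [empDiff, empJointCF_eq, empProductCF_eq]
  linarith

lemma norm_empSimplifiedDiff_le {n : ℕ} (hn : 1 ≤ n) (x : ℕ → BlockSpace p) (t : BlockSpace p) :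
    ‖empSimplifiedDiff n x t‖ ≤ ‖t‖ * ((1 + d) * meanNorm n x) := by
  have h1 := norm_ecf_sub_one_le hn x t
  have h2 := norm_ecf_sub_one_le hn (cyclicBlocks n x) t
  have h3 := norm_sub_le (ecf n x t - 1) (ecf n (cyclicBlocks n x) t - 1)
  have h4 := mul_le_mul_of_nonneg_left (meanNorm_cyclicBlocks_le n x) (norm_nonneg t)
  rw [sub_sub_sub_cancel_right] at h3
  rw [empSimplifiedDiff, empJointCF_eq, empSimplifiedCF_eq]
  linarith

end Sample

/-! ### Almost sure pointwise convergence. -/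

section AlmostSureConvergence

/-- Almost sure pointwise convergence of the empirical characteristic functions of an identically
distributed sequence whose terms are independent when their indices differ by at least `m`; the
last `m - 1` terms of every sample may be replaced. -/
lemma ae_tendsto_ecf_of_gap_indep {E : Type*} [NormedAddCommGroup E] [InnerProductSpace ℝ E]
    [MeasurableSpace E] [BorelSpace E] [SecondCountableTopology E]
    {Ω : Type*} [MeasurableSpace Ω] {P : Measure Ω} [IsProbabilityMeasure P] {V : ℕ → Ω → E}
    {m : ℕ} (hm : 0 < m) {ν : Measure E} [IsProbabilityMeasure ν]
    (hV : ∀ k, AEMeasurable (V k) P) (hlaw : ∀ k, P.map (V k) = ν)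
    (hindep : ∀ a b, a + m ≤ b → IndepFun (V a) (V b) P)
    {x : Ω → ℕ → ℕ → E} (hx : ∀ ω n k, k + m ≤ n → x ω n k = V k ω)
    (hbdd : ∀ᵐ ω ∂P, ∃ M, ∀ n, meanNorm n (x ω n) ≤ M) :
    ∀ᵐ ω ∂P, ∀ t, Tendsto (fun n => ecf n (x ω n) t) atTop (𝓝 (charFun ν t)) := by
  have hpt : ∀ t : E, ∀ᵐ ω ∂P, Tendsto (fun n => ecf n (x ω n) t) atTop (𝓝 (charFun ν t)) := by
    intro t
    let g : E → ℂ := fun v => Complex.exp (Complex.I * ((inner ℝ t v : ℝ) : ℂ))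
    have hg : Measurable g := by
      have : Continuous g := by fun_prop
      exact this.measurable
    have hg1 : ∀ v, ‖g v‖ ≤ 1 := fun v => (Complex.norm_exp_I_mul_ofReal _).le
    have hident : ∀ k, IdentDistrib (V k) (V 0) P P := fun k =>
      ⟨hV k, hV 0, by rw [hlaw, hlaw]⟩
    have hmean : ∫ ω, g (V 0 ω) ∂P = charFun ν t := by
      rw [charFun_apply, ← hlaw 0, integral_map (hV 0)]
      · refine integral_congr_ae (Eventually.of_forall fun ω => ?_)
        simp only [g, real_inner_comm, mul_comm]
      · exact Continuous.aestronglyMeasurable (by fun_prop)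
    have hlln := ae_tendsto_average_of_gap_indep (P := P) (Z := fun k ω => g (V k ω)) hm
      (B := 1) (fun k ω => hg1 _) (fun a b hab => (hindep a b hab).comp hg hg)
      (fun k => (hident k).comp hg)
    filter_upwards [hlln] with ω hω
    rw [← hmean]
    -- At most `m` indices `k < n` have `k + m > n`, and each changes the sum by at most `2`.
    refine hω (fun n => ∑ k ∈ Finset.range n, g (x ω n k)) (m * 2) fun n => ?_
    rw [← Finset.sum_sub_distrib, ← Finset.sum_filter_add_sum_filter_not _ (fun k => k + m ≤ n)]
    rw [Finset.sum_eq_zero (s := (Finset.range n).filter _), zero_add]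
    · refine (norm_sum_le_of_le (f := fun k => g (x ω n k) - g (V k ω)) _ (n := fun _ => (2 : ℝ))
        fun k _ => ?_).trans ?_
      · linarith [norm_sub_le (g (x ω n k)) (g (V k ω)), hg1 (x ω n k), hg1 (V k ω)]
      · rw [Finset.sum_const, nsmul_eq_mul]
        have hsub : (Finset.range n).filter (fun k => ¬ k + m ≤ n) ⊆ Finset.Ico (n - m) n := by
          intro k hk
          simp only [Finset.mem_filter, Finset.mem_range, Finset.mem_Ico] at hk ⊢
          omega
        have hcard := Finset.card_le_card hsub
        rw [Nat.card_Ico] at hcard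
        gcongr
        omega
    · intro k hk
      rw [hx ω n k (Finset.mem_filter.1 hk).2, sub_self]
  obtain ⟨D, hDc, hDd⟩ := TopologicalSpace.exists_countable_dense E
  filter_upwards [(ae_ball_iff hDc).2 fun t _ => hpt t, hbdd] with ω hω ⟨M, hM⟩
  exact tendsto_ecf_of_dense continuous_charFun hM hDd hω

lemma ae_exists_meanNorm_le {E : Type*} [NormedAddCommGroup E] [MeasurableSpace E] [BorelSpace E]
    {Ω : Type*} [MeasurableSpace Ω] {P : Measure Ω} {S : ℕ → Ω → E}
    (hint : Integrable (S 0) P) (hindep : iIndepFun S P)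
    (hident : ∀ k, IdentDistrib (S k) (S 0) P P) :
    ∀ᵐ ω ∂P, ∃ M, ∀ n, meanNorm n (fun k => S k ω) ≤ M := by
  have h := strong_law_ae_real (fun k ω => ‖S k ω‖) hint.norm
    (fun i j hij => (hindep.indepFun hij).comp measurable_norm measurable_norm)
    (fun k => (hident k).comp measurable_norm)
  filter_upwards [h] with ω hω
  obtain ⟨M, hM⟩ := hω.bddAbove_range
  refine ⟨M, fun n => ?_⟩
  rw [meanNorm, inv_mul_eq_div]
  exact hM ⟨n, rfl⟩

variable {d : ℕ} {p : Fin d → ℕ} {Ω₀ : Type*} [MeasurableSpace Ω₀] {P₀ : Measure Ω₀}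
  {X : Ω₀ → BlockSpace p} {Ω : Type*} [MeasurableSpace Ω] {P : Measure Ω}
  {S : ℕ → Ω → BlockSpace p}

lemma measurable_block (j : Fin d) : Measurable fun v : BlockSpace p => v j := by
  have : Continuous fun v : BlockSpace p => v j := by fun_prop
  exact this.measurable

lemma measurable_toLp_blockSpace :
    Measurable (WithLp.toLp 2 : (∀ j, EuclideanSpace ℝ (Fin (p j))) → BlockSpace p) :=
  (PiLp.continuous_toLp 2 _).measurable

/-- The law of a vector with independent blocks that have the marginal laws of `X`. -/
def productLaw (P₀ : Measure Ω₀) (X : Ω₀ → BlockSpace p) : Measure (BlockSpace p) :=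
  (Measure.pi fun j => P₀.map fun ω => X ω j).map (WithLp.toLp 2)

lemma charFun_productLaw [IsProbabilityMeasure P₀] : charFun (productLaw P₀ X) = productCF P₀ X := by
  funext t
  exact charFun_pi t

lemma aemeasurable_shiftedBlocks (hS : ∀ k, AEMeasurable (S k) P) (k : ℕ) :
    AEMeasurable (fun ω => shiftedBlocks (fun k => S k ω) k) P :=
  measurable_toLp_blockSpace.comp_aemeasurable <|
    aemeasurable_pi_lambda _ fun j => (measurable_block j).comp_aemeasurable (hS (k + j))

/-- The blocks come from observations with distinct indices `k + j`, so they are independent and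
keep their marginal laws. -/
lemma map_shiftedBlocks [IsProbabilityMeasure P] (hindep : iIndepFun S P)
    (hident : ∀ k, IdentDistrib (S k) X P P₀) (k : ℕ) :
    P.map (fun ω => shiftedBlocks (fun k => S k ω) k) = productLaw P₀ X := by
  have hS := fun k => (hident k).aemeasurable_fst
  have hmeas : ∀ j : Fin d, AEMeasurable (fun ω => S (k + j) ω j) P := fun j =>
    (measurable_block j).comp_aemeasurable (hS (k + j))
  have hinj : Function.Injective fun j : Fin d => k + (j : ℕ) := fun i j hij =>
    Fin.ext (Nat.add_left_cancel hij)
  have h1 : iIndepFun (fun (j : Fin d) ω => S (k + j) ω j) P :=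
    (hindep.precomp hinj).comp (fun j (v : BlockSpace p) => v j) measurable_block
  have h2 := h1.map_fun_eq_pi_map hmeas
  have h3 : ∀ j : Fin d, P.map (fun ω => S (k + j) ω j) = P₀.map fun ω => X ω j := fun j =>
    ((hident (k + j)).comp (measurable_block j)).map_eq
  simp_rw [h3] at h2
  rw [productLaw, ← h2, AEMeasurable.map_map_of_aemeasurable
    measurable_toLp_blockSpace.aemeasurable (aemeasurable_pi_lambda _ hmeas)]
  rfl

/-- The two vectors depend on disjoint windows of `d` observations. -/
lemma indepFun_shiftedBlocks (hindep : iIndepFun S P) (hS : ∀ k, AEMeasurable (S k) P) {a b m : ℕ}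
    (hm : d ≤ m) (hab : a + m ≤ b) :
    IndepFun (fun ω => shiftedBlocks (fun k => S k ω) a)
      (fun ω => shiftedBlocks (fun k => S k ω) b) P := by
  have hdisj : Disjoint (Finset.Ico a (a + d)) (Finset.Ico b (b + d)) := by
    rw [Finset.disjoint_left]
    intro i hi hi'
    rw [Finset.mem_Ico] at hi hi'
    omega
  have h := hindep.indepFun_finset₀ _ _ hdisj hS
  let g (c : ℕ) (u : Finset.Ico c (c + d) → BlockSpace p) : BlockSpace p :=
    WithLp.toLp 2 fun j => u ⟨c + j, Finset.mem_Ico.2 ⟨by omega, by omega⟩⟩ j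
  have hg : ∀ c, Measurable (g c) := fun c =>
    measurable_toLp_blockSpace.comp <|
      measurable_pi_lambda _ fun j => (measurable_block j).comp (measurable_pi_apply _)
  exact h.comp (hg a) (hg b)

lemma ae_tendsto_empJointCF [IsProbabilityMeasure P₀] [IsProbabilityMeasure P]
    (hindep : iIndepFun S P) (hident : ∀ k, IdentDistrib (S k) X P P₀)
    (hbdd : ∀ᵐ ω ∂P, ∃ M, ∀ n, meanNorm n (fun k => S k ω) ≤ M) :
    ∀ᵐ ω ∂P, ∀ t, Tendsto (fun n => empJointCF n (fun k => S k ω) t) atTop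
      (𝓝 (jointCF P₀ X t)) := by
  have : IsProbabilityMeasure (P₀.map X) :=
    Measure.isProbabilityMeasure_map (hident 0).aemeasurable_snd
  exact ae_tendsto_ecf_of_gap_indep (x := fun ω _ k => S k ω) one_pos
    (fun k => (hident k).aemeasurable_fst) (fun k => (hident k).map_eq)
    (fun a b hab => hindep.indepFun (by omega)) (fun _ _ _ _ => rfl) hbdd

lemma ae_tendsto_empSimplifiedCF [IsProbabilityMeasure P₀] [IsProbabilityMeasure P]
    (hindep : iIndepFun S P) (hident : ∀ k, IdentDistrib (S k) X P P₀)
    (hbdd : ∀ᵐ ω ∂P, ∃ M, ∀ n, meanNorm n (fun k => S k ω) ≤ M) :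
    ∀ᵐ ω ∂P, ∀ t, Tendsto (fun n => empSimplifiedCF n (fun k => S k ω) t) atTop
      (𝓝 (productCF P₀ X t)) := by
  have hS := fun k => (hident k).aemeasurable_fst
  have : IsProbabilityMeasure (productLaw P₀ X) := by
    rw [← map_shiftedBlocks hindep hident 0]
    exact Measure.isProbabilityMeasure_map (aemeasurable_shiftedBlocks hS 0)
  simp_rw [empSimplifiedCF_eq, ← charFun_productLaw]
  -- The gap is `d + 1` rather than `d` so that it is positive even for `d = 0`.
  refine ae_tendsto_ecf_of_gap_indep (x := fun ω n => cyclicBlocks n fun k => S k ω)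
    d.succ_pos (aemeasurable_shiftedBlocks hS) (map_shiftedBlocks hindep hident)
    (fun a b hab => indepFun_shiftedBlocks hindep hS d.le_succ hab)
    (fun ω n k h => cyclicBlocks_eq_shiftedBlocks _ (by omega)) ?_
  filter_upwards [hbdd] with ω ⟨M, hM⟩
  exact ⟨d * M, fun n => (meanNorm_cyclicBlocks_le n _).trans (by gcongr; exact hM n)⟩

lemma inner_single_block (j : Fin d) (s : EuclideanSpace ℝ (Fin (p j))) (v : BlockSpace p) :
    inner ℝ (WithLp.toLp 2 (Pi.single j s) : BlockSpace p) v = inner ℝ s (v j) := by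
  rw [PiLp.inner_apply, Finset.sum_eq_single j]
  · simp
  · intro i _ hi
    simp [Pi.single_eq_of_ne hi]
  · simp

lemma ecf_single_block (n : ℕ) (x : ℕ → BlockSpace p) (j : Fin d)
    (s : EuclideanSpace ℝ (Fin (p j))) :
    ecf n x (WithLp.toLp 2 (Pi.single j s)) = ecf n (fun k => x k j) s := by
  simp_rw [ecf, inner_single_block]

lemma jointCF_single_block (hX : AEMeasurable X P₀) (j : Fin d)
    (s : EuclideanSpace ℝ (Fin (p j))) :
    jointCF P₀ X (WithLp.toLp 2 (Pi.single j s)) = charFun (P₀.map fun ω => X ω j) s := by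
  have hXj : AEMeasurable (fun ω => X ω j) P₀ := (measurable_block j).comp_aemeasurable hX
  rw [jointCF, charFun_apply, charFun_apply, integral_map hX
    (Continuous.aestronglyMeasurable (by fun_prop)),
    integral_map hXj (Continuous.aestronglyMeasurable (by fun_prop))]
  simp_rw [real_inner_comm (WithLp.toLp 2 (Pi.single j s) : BlockSpace p), inner_single_block,
    real_inner_comm s]

/-- Marginal characteristic functions are joint ones at vectors with a single nonzero block, so no
further null set is needed. -/
lemma tendsto_empProductCF (hX : AEMeasurable X P₀) {x : ℕ → BlockSpace p}
    (h : ∀ t, Tendsto (fun n => empJointCF n x t) atTop (𝓝 (jointCF P₀ X t)))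
    (t : BlockSpace p) :
    Tendsto (fun n => empProductCF n x t) atTop (𝓝 (productCF P₀ X t)) := by
  simp_rw [empProductCF_eq]
  refine tendsto_finsetProd _ fun j _ => ?_
  rw [← jointCF_single_block hX]
  refine (h _).congr fun n => ?_
  rw [empJointCF_eq, ecf_single_block]

lemma continuous_cfDiff [IsProbabilityMeasure P₀] (hX : AEMeasurable X P₀) :
    Continuous (cfDiff P₀ X) := by
  have : IsProbabilityMeasure (P₀.map X) := Measure.isProbabilityMeasure_map hX
  have hj : ∀ j, IsProbabilityMeasure (P₀.map fun ω => X ω j) := fun j =>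
    Measure.isProbabilityMeasure_map ((measurable_block j).comp_aemeasurable hX)
  refine continuous_charFun.sub (continuous_finsetProd _ fun j _ => ?_)
  exact continuous_charFun.comp (by fun_prop)

end AlmostSureConvergence

end

end MutualDependence

open MutualDependence in
theorem mainTheorem4 {d : ℕ} (p : Fin d → ℕ)
    {Ω₀ : Type*} [MeasurableSpace Ω₀] (P₀ : Measure Ω₀) [IsProbabilityMeasure P₀]
    (X : Ω₀ → MutualDependence.BlockSpace p)
    {Ω : Type*} [MeasurableSpace Ω] (P : Measure Ω) [IsProbabilityMeasure P]
    (S : ℕ → Ω → MutualDependence.BlockSpace p)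
    (hindep : iIndepFun S P)
    (hident : ∀ k, IdentDistrib (S k) X P P₀)
    (hX : Integrable X P₀) :
    Integrable (MutualDependence.weightedSq (MutualDependence.cfDiff P₀ X)) ∧
    (∀ (ω : Ω) (n : ℕ), 1 ≤ n →
      Integrable (MutualDependence.weightedSq (MutualDependence.empDiff n (fun k => S k ω))) ∧
      Integrable
        (MutualDependence.weightedSq (MutualDependence.empSimplifiedDiff n (fun k => S k ω)))) ∧
    (∀ᵐ ω ∂P, Tendsto (fun n : ℕ => MutualDependence.empQ n (fun k => S k ω)) atTop
      (𝓝 (MutualDependence.Q P₀ X))) ∧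
    (∀ᵐ ω ∂P, Tendsto (fun n : ℕ => MutualDependence.empQStar n (fun k => S k ω)) atTop
      (𝓝 (MutualDependence.Q P₀ X))) := by
  have hX' : AEMeasurable X P₀ := (hident 0).aemeasurable_snd
  have hbdd : ∀ᵐ ω ∂P, ∃ M, ∀ n, meanNorm n (fun k => S k ω) ≤ M :=
    ae_exists_meanNorm_le ((hident 0).integrable_iff.2 hX) hindep
      fun k => (hident k).trans (hident 0).symm
  have hbound : ∀ (ω : Ω) (M : ℝ), (∀ n, meanNorm n (fun k => S k ω) ≤ M) → ∀ n, 1 ≤ n →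
      ∀ t : BlockSpace p, ‖t‖ * ((1 + d) * meanNorm n (fun k => S k ω)) ≤ ‖t‖ * ((1 + d) * M) := by
    intro ω M hM n _ t
    gcongr
    exact hM n
  have hjoint := ae_tendsto_empJointCF hindep hident hbdd
  have hdiff : ∀ᵐ ω ∂P, ∀ t, Tendsto (fun n => empDiff n (fun k => S k ω) t) atTop
      (𝓝 (cfDiff P₀ X t)) := by
    filter_upwards [hjoint] with ω hω t
    exact (hω t).sub (tendsto_empProductCF hX' hω t)
  refine ⟨?_, fun ω n hn => ⟨?_, ?_⟩, ?_, ?_⟩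
  -- The population difference inherits both bounds as a pointwise limit along a single good sample
  -- path.
  · obtain ⟨ω, ⟨M, hM⟩, hω⟩ := (hbdd.and hdiff).exists
    refine integrable_weightedSq (continuous_cfDiff hX') (M := (1 + d) * M) (fun t => ?_)
      fun t => ?_
    · exact le_of_tendsto (hω t).norm (Eventually.of_forall fun n => norm_empDiff_le_two n _ t)
    · refine le_of_tendsto (hω t).norm ?_
      filter_upwards [eventually_ge_atTop 1] with n hn
      exact (norm_empDiff_le hn _ t).trans (hbound ω M hM n hn t)
  · exact integrable_weightedSq (continuous_empDiff n _) (norm_empDiff_le_two n _)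
      (norm_empDiff_le hn _)
  · exact integrable_weightedSq (continuous_empSimplifiedDiff n _)
      (norm_empSimplifiedDiff_le_two n _) (norm_empSimplifiedDiff_le hn _)
  · filter_upwards [hbdd, hdiff] with ω ⟨M, hM⟩ hω
    exact tendsto_weightedNormSq (fun n => continuous_empDiff n _)
      (fun n => norm_empDiff_le_two n _)
      (fun n hn t => (norm_empDiff_le hn _ t).trans (hbound ω M hM n hn t)) hω
  · filter_upwards [hbdd, hjoint, ae_tendsto_empSimplifiedCF hindep hident hbdd]
      with ω ⟨M, hM⟩ hω hω'
    exact tendsto_weightedNormSq (fun n => continuous_empSimplifiedDiff n _)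
      (fun n => norm_empSimplifiedDiff_le_two n _)
      (fun n hn t => (norm_empSimplifiedDiff_le hn _ t).trans (hbound ω M hM n hn t))
      fun t => (hω t).sub (hω' t)
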